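/- \textbf{Theorem (Main theorem of Zagier).} Let $n\ge 1$, let $K$ be a conjugacy class of the symmetric group $S_n$, and let $\sigma\in S_n$ be an $n$-cycle. For $1\le i\le n$ put \[p_i(K)=\frac{|\{\tau\in K\mid \tau\sigma \text{ has } i \text{ cycles}\}|}{|K|},\] where fixed points are counted as cycles. For $i\ge 1$ let $P_i(X)=\sum_{k=1}^\infty k^i X^{k-1}$. Each $P_i$ is a polynomial in $\frac1{1-X}$ with integer coefficients, and \[P_1(X)=\frac{1}{(1-X)^2},\quad P_2(X)=\frac{1+X}{(1-X)^3},\quad P_3(X)=\frac{1+4X+X^2}{(1-X)^4}.\] For every $\tau\in K$, the following identity holds in $\mathbb C[[X]]$: \[\sum_{i=1}^n p_i(K)\,P_i(X)=\frac{\det(1-\tau X,\mathbb C^n)}{(1-X)^{n+2}},\] where $\tau$ acts on $\mathbb C^n$ by the permutation matrix $(\delta_{i\tau(j)})_{i,j}$. Moreover, this identity determines the numbers $p_i(K)$: if $q_1,\dots,q_n\in\mathbb C$ satisfy $\sum_{i=1}^n q_iP_i(X)=\det(1-\tau X,\mathbb C^n)/(1-X)^{n+2}$ for some $\tau\in K$,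 then $q_i=p_i(K)$ for $1\le i\le n$. -/

import Mathlib

open scoped PowerSeries Polynomial

/-- The number `ℓ(π)` of cycles of a permutation `π ∈ S_n`, fixed points counted as cycles of
length one. -/
def numCycles {n : ℕ} (π : Equiv.Perm (Fin n)) : ℕ :=
  Multiset.card π.partition.parts

/-- `σ ∈ S_n` is an `n`-cycle: its cycle decomposition, fixed points included, has exactly one
cycle. For `n = 1` this holds for the identity, for `n = 0` it never holds. -/
def IsNCycle {n : ℕ} (σ : Equiv.Perm (Fin n)) : Prop :=
  numCycles σ = 1

/-- The proportion `p_i(K) = |{τ ∈ K : τσ has i cycles}| / |K|`. -/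
noncomputable def cycleProportion {n : ℕ} (K : ConjClasses (Equiv.Perm (Fin n)))
    (σ : Equiv.Perm (Fin n)) (i : ℕ) : ℚ :=
  ({τ : Equiv.Perm (Fin n) | τ ∈ K.carrier ∧ numCycles (τ * σ) = i}.ncard : ℚ) /
    (K.carrier.ncard : ℚ)

/-- The power series `P_i(X) = ∑_{k ≥ 1} k^i X^{k-1}`. -/
noncomputable def zagierP (i : ℕ) : ℂ⟦X⟧ :=
  PowerSeries.mk fun m => ((m + 1 : ℕ) : ℂ) ^ i

/-- The matrix `(δ_{iτ(j)})_{i,j}` of `τ` in the permutation representation on `ℂ^n`. -/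
def permRepMatrix {n : ℕ} (τ : Equiv.Perm (Fin n)) : Matrix (Fin n) (Fin n) ℂ :=
  Matrix.of fun i j => if i = τ j then 1 else 0

/-- The polynomial `det(1 - τX, ℂ^n)`. -/
noncomputable def permCharPoly {n : ℕ} (τ : Equiv.Perm (Fin n)) : ℂ[X] :=
  (1 - (Polynomial.X : ℂ[X]) • (permRepMatrix τ).map Polynomial.C).det

/-! Write ℓ for the number of cycles and D_Y(τ) for the determinant of 1 - Yτ on the standard
representation, so that det(1 - Yτ) = (1 - Y) D_Y(τ). Comparing coefficients of X^(k-1), the theorem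
says that the average of k^ℓ(ρσ) over ρ in K is the corresponding coefficient of D_X(τ) / (1 -
X)^(n+1).

The n-cycles are isolated by the weight D_1: it vanishes off them, because any other permutation
fixes a nonzero vector of the standard representation, and it sums to n! over S_n. Conjugation makes
the sum of k^ℓ(ρσ) over ρ in K the same for all n-cycles σ, so it suffices to evaluate ∑_σ k^ℓ(ρσ)
D_1(σ) for fixed ρ (`sum_pow_numCycles_mul_stdDet`).

The coefficients of D_Y in Y are, up to sign, the characters of the exterior powers of the standard
representation, that is, the hook characters. The central element ∑_π k^ℓ(π) π acts on each by a
scalar, a product of n consecutive integers. Here this is proved without characters: D_Y is expanded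
into principal minors of a permutation matrix with one row replaced by ones (`stdDet_eq_sum`), and
`sum_invariantColorings_mul_det` gives the scalar for such minors. The scalars are n! times the
coefficients of X^(s-1) / (1 - X)^(n+1), which produces the right-hand side
(`coeff_stdDet_mul_inv`). -/

/-! ### Invariant colourings and the signed sum over permutations -/

/-- The number of colourings of `α` in `k` colours that are constant on the cycles of `π`. -/
noncomputable def invariantColorings {α : Type*} (k : ℕ) (π : Equiv.Perm α) : ℕ :=
  Nat.card {f : α → Fin k // ∀ a, f (π a) = f a}

theorem invariantColorings_permCongr {α β : Type*} (k : ℕ) (e : α ≃ β) (π : Equiv.Perm α) :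
    invariantColorings k (e.permCongr π) = invariantColorings k π := by
  refine (Nat.card_congr ((e.arrowCongr (Equiv.refl _)).subtypeEquiv fun f => ?_)).symm
  constructor
  · intro h b
    simpa using h (e.symm b)
  · intro h a
    simpa using h (e a)

theorem invariantColorings_optionCongr {α : Type*} (k : ℕ) (π : Equiv.Perm α) :
    invariantColorings k π.optionCongr = k * invariantColorings k π := by
  have e : {f : Option α → Fin k // ∀ a, f (π.optionCongr a) = f a} ≃
      Fin k × {f : α → Fin k // ∀ a, f (π a) = f a} :=
    { toFun := fun f => (f.1 none, ⟨fun a => f.1 (some a), fun a => f.2 (some a)⟩)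
      invFun := fun p => ⟨fun o => o.elim p.1 p.2.1, fun o => by
        cases o with
        | none => rfl
        | some a => exact p.2.2 a⟩
      left_inv := fun f => by
        ext o
        cases o <;> rfl
      right_inv := fun p => rfl }
  rw [invariantColorings, Nat.card_congr e, Nat.card_prod, Nat.card_fin, invariantColorings]

/-- The swap inserts `none` into the cycle of `x`, just before `x`, so no new cycle arises and the
colour of `none` is forced. -/
theorem invariantColorings_swap_mul_optionCongr {α : Type*} [DecidableEq α] (k : ℕ)
    (π : Equiv.Perm α) (x : α) :
    invariantColorings k (Equiv.swap none (some x) * π.optionCongr) = invariantColorings k π := by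
  have key : ∀ f : Option α → Fin k,
      (∀ a, f ((Equiv.swap none (some x) * π.optionCongr) a) = f a) →
        f none = f (some x) ∧ ∀ a, f (some (π a)) = f (some a) := by
    intro f hf
    have h0 : f (some x) = f none := by simpa using hf none
    refine ⟨h0.symm, fun a => ?_⟩
    have h1 := hf (some a)
    by_cases hx : π a = x
    · subst hx
      rw [← h1]
      simpa using h0
    · rw [← h1]
      simp [Equiv.swap_apply_of_ne_of_ne, hx]
  refine Nat.card_congr
    { toFun := fun f => ⟨fun a => f.1 (some a), (key f.1 f.2).2⟩
      invFun := fun f => ⟨fun o => o.elim (f.1 x) f.1, fun o => ?_⟩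
      left_inv := fun f => ?_
      right_inv := fun f => rfl }
  · cases o with
    | none => simp
    | some a =>
      by_cases hx : π a = x
      · simp [hx, ← f.2 a]
      · simp [Equiv.swap_apply_of_ne_of_ne, hx, f.2 a]
  · ext o
    cases o with
    | none => simp [(key f.1 f.2).1]
    | some a => rfl

theorem sum_perm_option {α M : Type*} [Fintype α] [DecidableEq α] [AddCommMonoid M]
    (F : Equiv.Perm (Option α) → M) :
    ∑ π, F π = ∑ π : Equiv.Perm α, F π.optionCongr +
      ∑ x : α, ∑ π : Equiv.Perm α, F (Equiv.swap none (some x) * π.optionCongr) := by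
  rw [← Equiv.sum_comp Equiv.Perm.decomposeOption.symm F, Fintype.sum_prod_type,
    Fintype.sum_option]
  simp [← Equiv.Perm.one_def]

theorem sum_invariantColorings_mul_sign (k : ℕ) (α : Type*) [Fintype α] [DecidableEq α] :
    ∑ π : Equiv.Perm α, (invariantColorings k π : ℤ) * (Equiv.Perm.sign π : ℤ) =
      k.descFactorial (Fintype.card α) := by
  classical
  suffices h : ∀ [Fintype α] [DecidableEq α], ∑ π : Equiv.Perm α,
      (invariantColorings k π : ℤ) * (Equiv.Perm.sign π : ℤ) =
      k.descFactorial (Fintype.card α) from h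
  refine Finite.induction_empty_option (P := fun α => ∀ [Fintype α] [DecidableEq α],
    ∑ π : Equiv.Perm α, (invariantColorings k π : ℤ) * (Equiv.Perm.sign π : ℤ) =
      k.descFactorial (Fintype.card α)) ?_ ?_ ?_ α
  · intro α β e h _ _
    let _ := Fintype.ofEquiv β e.symm
    let _ := e.decidableEq
    rw [← Fintype.card_congr e, ← h, ← Equiv.sum_comp e.permCongr]
    simp only [invariantColorings_permCongr, Equiv.Perm.sign_permCongr]
  · intro _ _
    simp [invariantColorings]
  · intro α _ h _ _
    have h := @h _ (Classical.decEq α)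
    have : ‹DecidableEq (Option α)› = @Option.instDecidableEq α (Classical.decEq α) :=
      Subsingleton.elim _ _
    subst this
    have : ‹Fintype (Option α)› = instFintypeOption := Subsingleton.elim _ _
    subst this
    rw [sum_perm_option]
    simp only [invariantColorings_optionCongr, invariantColorings_swap_mul_optionCongr,
      Equiv.Perm.sign_mul, Equiv.optionCongr_sign]
    simp [mul_assoc, ← Finset.mul_sum, h, Nat.descFactorial_succ]
    -- The new factor is the integer k - |α|, whereas `descFactorial` truncates the subtraction; for
    -- k < |α| the other factor is already zero.
    rcases le_or_gt (Fintype.card α) k with hk | hk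
    · push_cast [hk]
      ring
    · simp [Nat.descFactorial_of_lt hk]

/-! ### Minors of a matrix with a row of ones -/

/-- Cramer's identity M · cramer(M, b) = det(M) b for the column b = R(·, a), read in the row of
ones. -/
theorem sum_det_submatrix_update {ι α A : Type*} [Fintype ι] [DecidableEq ι] [CommRing A]
    (R : Matrix ι α A) (i₀ : ι) (h : ∀ a, R i₀ a = 1) (q : ι → α) (a : α) :
    ∑ i, (R.submatrix id (Function.update q i a)).det = (R.submatrix id q).det := by
  have h1 := congrFun ((R.submatrix id q).mulVec_cramer (fun i => R i a)) i₀
  simp only [Matrix.mulVec, dotProduct, Matrix.submatrix_apply, id, h, one_mul, Pi.smul_apply,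
    smul_eq_mul, mul_one, Matrix.cramer_apply] at h1
  rw [← h1]
  refine Finset.sum_congr rfl fun i _ => congrArg _ ?_
  ext s t
  by_cases ht : t = i
  · subst ht; simp
  · simp [ht]

theorem sum_invariantColorings_mul_det_of_bijective {ι α A : Type*} [Fintype ι] [DecidableEq ι]
    [Fintype α] [DecidableEq α] [CommRing A] (k : ℕ) (R : Matrix ι α A) (q : ι ≃ α) :
    ∑ π : Equiv.Perm α, (invariantColorings k π : A) * (R.submatrix id (π ∘ q)).det =
      k.descFactorial (Fintype.card ι) * (R.submatrix id q).det := by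
  have h := congrArg (Int.cast : ℤ → A) (sum_invariantColorings_mul_sign k ι)
  push_cast at h
  rw [← h, ← Equiv.sum_comp q.permCongr, Finset.sum_mul]
  refine Finset.sum_congr rfl fun π _ => ?_
  rw [invariantColorings_permCongr, mul_assoc, ← Matrix.det_permute']
  congr 2
  ext i j
  simp

/-- Adding one unused column multiplies the scalar by k + 1 + r. Fixing `none` contributes k.
Swapping it with one of the r columns outside the range of `q` changes nothing, and contributes r in
all. Swapping it with the columns in the range replaces each in turn by the new column, which
contributes 1 by `sum_det_submatrix_update`. -/
theorem sum_invariantColorings_mul_det_option {ι α A : Type*} [Fintype ι] [DecidableEq ι]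
    [Fintype α] [DecidableEq α] [CommRing A] (k r : ℕ) (q : ι → α) (hq : Function.Injective q)
    (hr : Fintype.card α = Fintype.card ι + r) (c : A)
    (ih : ∀ (R : Matrix ι α A) (i₀ : ι), (∀ a, R i₀ a = 1) →
      ∑ π : Equiv.Perm α, (invariantColorings k π : A) * (R.submatrix id (π ∘ q)).det =
        c * (R.submatrix id q).det)
    (R : Matrix ι (Option α) A) (i₀ : ι) (h : ∀ a, R i₀ a = 1) :
    ∑ π : Equiv.Perm (Option α),
        (invariantColorings k π : A) * (R.submatrix id (π ∘ some ∘ q)).det =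
      (k + 1 + r : ℕ) * c * (R.submatrix id (some ∘ q)).det := by
  have step : ∀ x : Option α, ∑ π : Equiv.Perm α, (invariantColorings k π : A) *
      (R.submatrix id ((Equiv.swap none x * π.optionCongr : Equiv.Perm _) ∘ some ∘ q)).det =
      c * (R.submatrix id (Equiv.swap none x ∘ some ∘ q)).det := fun x =>
    ih (R.submatrix id (Equiv.swap none x ∘ some)) i₀ fun a => h _
  have hsum : ∑ x : α, (R.submatrix id (Equiv.swap none (some x) ∘ some ∘ q)).det =
      (r + 1 : A) * (R.submatrix id (some ∘ q)).det := by
    rw [← Finset.sum_filter_add_sum_filter_not _ (fun x => x ∈ Set.range q)]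
    have h1 : ∑ x ∈ Finset.univ.filter (· ∈ Set.range q),
        (R.submatrix id (Equiv.swap none (some x) ∘ some ∘ q)).det =
        (R.submatrix id (some ∘ q)).det := by
      rw [← sum_det_submatrix_update R i₀ h (some ∘ q) none]
      symm
      refine Finset.sum_nbij q (by simp) hq.injOn (fun x => by simp) fun i _ => ?_
      congr 2
      ext j : 1
      by_cases hj : j = i
      · subst hj; simp
      · simp [hj, Equiv.swap_apply_of_ne_of_ne, hq.ne hj]
    have h2 : ∀ x ∈ Finset.univ.filter (· ∉ Set.range q),
        (R.submatrix id (Equiv.swap none (some x) ∘ some ∘ q)).det =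
        (R.submatrix id (some ∘ q)).det := by
      intro x hx
      congr 2
      ext j : 1
      have : q j ≠ x := fun hj => (Finset.mem_filter.1 hx).2 ⟨j, hj⟩
      simp [Equiv.swap_apply_of_ne_of_ne, this]
    have h3 : (Finset.univ.filter (· ∉ Set.range q)).card = r := by
      have h4 : (Finset.univ.filter (· ∈ Set.range q)).card = Fintype.card ι := by
        rw [← Finset.card_univ (α := ι), ← Finset.card_image_of_injective _ hq]
        congr 1
        ext x
        simp
      have := Finset.card_filter_add_card_filter_not (s := (Finset.univ : Finset α))
        (· ∈ Set.range q)
      rw [Finset.card_univ] at this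
      omega
    rw [h1, Finset.sum_congr rfl h2, Finset.sum_const, h3, nsmul_eq_mul]
    ring
  rw [sum_perm_option]
  simp only [invariantColorings_optionCongr, invariantColorings_swap_mul_optionCongr, step,
    ← Finset.mul_sum, hsum]
  have h0 := step none
  simp only [Equiv.swap_self, ← Equiv.Perm.one_def, one_mul, Equiv.Perm.coe_one,
    Function.id_comp] at h0
  push_cast
  simp only [mul_assoc, ← Finset.mul_sum, h0]
  ring

theorem sum_invariantColorings_mul_det {ι A : Type*} [Fintype ι] [DecidableEq ι]
    [CommRing A] (k r : ℕ) : ∀ (α : Type*) [Fintype α] [DecidableEq α] (q : ι → α)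
    (_ : Function.Injective q) (_ : Fintype.card α = Fintype.card ι + r)
    (R : Matrix ι α A) (i₀ : ι) (_ : ∀ a, R i₀ a = 1),
    ∑ π : Equiv.Perm α, (invariantColorings k π : A) * (R.submatrix id (π ∘ q)).det =
      (k.descFactorial (Fintype.card ι) * (k + 1).ascFactorial r : ℕ) *
        (R.submatrix id q).det := by
  induction r with
  | zero =>
    intro α _ _ q hq hr R _ _
    have hb : Function.Bijective q :=
      (Fintype.bijective_iff_injective_and_card q).2 ⟨hq, by simpa using hr.symm⟩
    simpa using sum_invariantColorings_mul_det_of_bijective k R (Equiv.ofBijective q hb)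
  | succ r ih =>
    intro α _ _ q hq hr R i₀ h
    obtain ⟨y, hy⟩ : ∃ y, y ∉ Set.range q := by
      by_contra! hc
      have := Fintype.card_le_of_surjective q hc
      omega
    -- A column `y` missed by `q` plays the role of `none`.
    let e : Option {x // x ≠ y} ≃ α := Equiv.optionSubtypeNe y
    let q' : ι → {x // x ≠ y} := fun i => ⟨q i, fun hi => hy ⟨i, hi⟩⟩
    have hq' : Function.Injective q' := fun i j hij => hq (congrArg Subtype.val hij)
    have hr' : Fintype.card {x // x ≠ y} = Fintype.card ι + r := by
      have := Fintype.card_congr e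
      rw [Fintype.card_option] at this
      omega
    have key := sum_invariantColorings_mul_det_option k r q' hq' hr' _ (ih _ q' hq' hr')
      (R.submatrix id e) i₀ fun a => h _
    rw [← Equiv.sum_comp e.permCongr]
    have hqe : ∀ i, e.symm (q i) = some (q' i) := fun i => by
      rw [Equiv.symm_apply_eq]
      simp [e, q']
    have e1 : ∀ π : Equiv.Perm (Option {x // x ≠ y}), R.submatrix id (e.permCongr π ∘ q) =
        (R.submatrix id e).submatrix id (π ∘ some ∘ q') := fun π => by
      ext i j
      simp [hqe]
    have e2 : (R.submatrix id e).submatrix id (some ∘ q') = R.submatrix id q := by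
      ext i j
      simp [← hqe]
    rw [e2] at key
    simp only [invariantColorings_permCongr, e1, key, Nat.ascFactorial_succ]
    push_cast
    ring

/-! ### Cycle counts and n-cycles -/

theorem card_quotient_sameCycle {α : Type*} [Fintype α] [DecidableEq α] (π : Equiv.Perm α) :
    Nat.card (Quotient (Equiv.Perm.SameCycle.setoid π)) =
      Multiset.card π.partition.parts := by
  let g : α → π.cycleFactorsFinset ⊕ {x // π x = x} := fun x =>
    if h : π x = x then Sum.inr ⟨x, h⟩ else
      Sum.inl ⟨π.cycleOf x, Equiv.Perm.cycleOf_mem_cycleFactorsFinset_iff.2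
        (Equiv.Perm.mem_support.2 h)⟩
  have hg : ∀ x y, π.SameCycle x y ↔ g x = g y := by
    intro x y
    by_cases hx : π x = x <;> by_cases hy : π y = y <;> simp only [g, hx, hy, dif_pos, dif_neg,
      not_false_eq_true, Sum.inr.injEq, Sum.inl.injEq, Subtype.mk.injEq, reduceCtorEq, iff_false]
    · exact ⟨fun h => h.eq_of_left hx, fun h => h ▸ Equiv.Perm.SameCycle.refl _ _⟩
    · exact fun h => hy (h.apply_eq_self_iff.1 hx)
    · exact fun h => hx (h.apply_eq_self_iff.2 hy)
    · refine ⟨fun h => h.cycleOf_eq, fun h => ?_⟩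
      have : y ∈ (π.cycleOf x).support := h ▸ Equiv.Perm.mem_support_cycleOf_iff.2
        ⟨Equiv.Perm.SameCycle.refl _ _, Equiv.Perm.mem_support.2 hy⟩
      exact (Equiv.Perm.mem_support_cycleOf_iff.1 this).1
  have hs : Function.Surjective g := by
    rintro (⟨c, hc⟩ | ⟨x, hx⟩)
    · obtain ⟨x, hx⟩ := (Equiv.Perm.mem_cycleFactorsFinset_iff.1 hc).1.nonempty_support
      have hx' : π x ≠ x := Equiv.Perm.mem_support.1
        (Equiv.Perm.mem_cycleFactorsFinset_support_le hc hx)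
      exact ⟨x, by simp [g, hx', (Equiv.Perm.cycle_is_cycleOf hx hc).symm]⟩
    · exact ⟨x, by simp [g, hx]⟩
  let G : Quotient (Equiv.Perm.SameCycle.setoid π) → π.cycleFactorsFinset ⊕ {x // π x = x} :=
    Quotient.lift g fun x y h => (hg x y).1 h
  have hG : Function.Bijective G := by
    refine ⟨fun a b => Quotient.inductionOn₂ a b fun x y h => Quotient.sound ((hg x y).2 h),
      fun z => ?_⟩
    obtain ⟨x, hx⟩ := hs z
    exact ⟨Quotient.mk _ x, hx⟩
  have hfix : Fintype.card {x // π x = x} = Fintype.card α - π.support.card := by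
    rw [← Finset.card_compl, Fintype.card_subtype]
    congr 1
    ext x
    simp
  rw [Nat.card_congr (Equiv.ofBijective G hG), Nat.card_eq_fintype_card, Fintype.card_sum,
    Fintype.card_coe, hfix, Equiv.Perm.parts_partition, Multiset.card_add,
    Multiset.card_replicate, Equiv.Perm.cycleType_def, Multiset.card_map, Finset.card_val]

theorem invariantColorings_eq_pow {n : ℕ} (k : ℕ) (π : Equiv.Perm (Fin n)) :
    invariantColorings k π = k ^ numCycles π := by
  have e : {f : Fin n → Fin k // ∀ a, f (π a) = f a} ≃
      (Quotient (Equiv.Perm.SameCycle.setoid π) → Fin k) :=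
    { toFun := fun f => Quotient.lift f.1 fun x y h => by
        obtain ⟨i, rfl⟩ : ∃ i : ℕ, (π ^ i) x = y :=
          (Equiv.Perm.SameCycle.exists_nat_pow_eq h)
        induction i with
        | zero => rfl
        | succ i ih => rw [pow_succ', Equiv.Perm.mul_apply, f.2]; exact ih ⟨i, by simp⟩
      invFun := fun f => ⟨fun x => f (Quotient.mk _ x), fun a => congrArg f (Quotient.sound
        (Equiv.Perm.sameCycle_apply_left.2 (Equiv.Perm.SameCycle.refl _ _)))⟩
      left_inv := fun f => rfl
      right_inv := fun f => by
        ext x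
        induction x using Quotient.inductionOn
        rfl }
  rw [invariantColorings, Nat.card_congr e, Nat.card_fun, Nat.card_fin, card_quotient_sameCycle,
    numCycles]

theorem numCycles_conj {n : ℕ} (g π : Equiv.Perm (Fin n)) :
    numCycles (g * π * g⁻¹) = numCycles π := by
  rw [numCycles, numCycles, Equiv.Perm.partition_eq_of_isConj.1 (isConj_iff.2 ⟨g, rfl⟩ :
    IsConj π (g * π * g⁻¹))]

theorem numCycles_le {n : ℕ} (π : Equiv.Perm (Fin n)) : numCycles π ≤ n := by
  have h := π.partition.parts_sum.trans (Fintype.card_fin n)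
  conv_rhs => rw [← h]
  simpa [numCycles] using Multiset.card_nsmul_le_sum (s := π.partition.parts) (a := 1)
    fun x hx => π.partition.parts_pos hx

theorem numCycles_pos {n : ℕ} (hn : n ≠ 0) (π : Equiv.Perm (Fin n)) : 0 < numCycles π := by
  rw [numCycles, Multiset.card_pos]
  intro h
  have := π.partition.parts_sum
  rw [h, Fintype.card_fin] at this
  exact hn (by simpa using this.symm)

theorem IsNCycle.ne_zero {n : ℕ} {σ : Equiv.Perm (Fin n)} (hσ : IsNCycle σ) : n ≠ 0 := by
  have := numCycles_le σ
  rw [IsNCycle] at hσ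
  omega

theorem IsNCycle.isConj {n : ℕ} {σ τ : Equiv.Perm (Fin n)} (hσ : IsNCycle σ) (hτ : IsNCycle τ) :
    IsConj σ τ := by
  have key : ∀ π : Equiv.Perm (Fin n), IsNCycle π → π.partition.parts = {n} := by
    intro π hπ
    obtain ⟨a, ha⟩ := Multiset.card_eq_one.1 hπ
    have := π.partition.parts_sum
    rw [ha, Multiset.sum_singleton, Fintype.card_fin] at this
    rw [ha, this]
  rw [Equiv.Perm.partition_eq_of_isConj]
  exact Nat.Partition.ext ((key σ hσ).trans (key τ hτ).symm)

/-- If all invariant 2-colourings were constant, there would be at most 2 of them, against 2^ℓ ≥ 4.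
-/
theorem exists_invariant_ne_of_not_isNCycle {n : ℕ} {π : Equiv.Perm (Fin n)}
    (hπ : ¬IsNCycle π) (i₀ : Fin n) :
    ∃ f : Fin n → Fin 2, (∀ a, f (π a) = f a) ∧ ∃ a, f a ≠ f i₀ := by
  by_contra! h
  have hn : n ≠ 0 := fun hn => (hn ▸ i₀).elim0
  have h1 : invariantColorings 2 π ≤ 2 := by
    rw [invariantColorings]
    refine (Nat.card_le_card_of_injective (fun f => f.1 i₀) fun f g hfg => ?_).trans_eq
      (Nat.card_fin 2)
    ext a
    rw [h f.1 f.2, h g.1 g.2]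
    exact congrArg _ hfg
  rw [invariantColorings_eq_pow] at h1
  have h2 := numCycles_pos hn π
  have h3 : 2 ≤ numCycles π := by
    have : numCycles π ≠ 1 := hπ
    omega
  have := Nat.pow_le_pow_right (n := 2) (by norm_num) h3
  omega

/-! ### Determinants on the standard representation -/

/-- The permutation matrix `(δ_{iτ(j)})_{i,j}` over a commutative ring. -/
def permMatrixOver (A : Type*) [CommRing A] {α : Type*} [DecidableEq α] (τ : Equiv.Perm α) :
    Matrix α α A :=
  Matrix.of fun i j => if i = τ j then 1 else 0

theorem permMatrixOver_apply (A : Type*) [CommRing A] {α : Type*} [DecidableEq α]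
    (τ : Equiv.Perm α) (i j : α) : permMatrixOver A τ i j = if i = τ j then 1 else 0 :=
  rfl

/-- `det(1 - Yτ)` with the row `i₀` replaced by the all-ones row: the determinant of `1 - Yτ` on the
standard representation. -/
noncomputable def stdDet {A : Type*} [CommRing A] {α : Type*} [Fintype α] [DecidableEq α] (i₀ : α)
    (Y : A) (τ : Equiv.Perm α) : A :=
  ((1 - Y • permMatrixOver A τ).updateRow i₀ 1).det

/-- The principal minor on `s` of the permutation matrix whose row `i₀` is replaced by ones. -/
noncomputable def borderedMinor (A : Type*) [CommRing A] {α : Type*} [Fintype α] [DecidableEq α]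
    (i₀ : α) (s : Finset α) (τ : Equiv.Perm α) : A :=
  (((permMatrixOver A τ).updateRow i₀ 1).submatrix (↑) (↑) : Matrix s s A).det

section
variable {A α : Type*} [CommRing A] [Fintype α] [DecidableEq α]

/-- Every column of 1 - Yτ sums to 1 - Y, so adding all rows to row `i₀` turns it into 1 - Y times
the row of ones. -/
theorem det_one_sub_smul_permMatrixOver (i₀ : α) (Y : A) (τ : Equiv.Perm α) :
    (1 - Y • permMatrixOver A τ).det = (1 - Y) * stdDet i₀ Y τ := by
  have h := Matrix.det_updateRow_sum (1 - Y • permMatrixOver A τ) i₀ (fun _ => 1)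
  rw [one_smul] at h
  rw [← h, stdDet, ← Matrix.det_updateRow_smul]
  congr 2
  ext j
  refine (Finset.sum_apply j _ _).trans ?_
  simp [permMatrixOver_apply, Matrix.one_apply, Finset.sum_sub_distrib]

/-- Each row is a multiple of a row of the bordered matrix plus an identity row, the latter replaced
by zero at `i₀`. In the multilinear expansion, sets missing `i₀` leave a zero row; the exponent is
|s| - 1 because row `i₀` carries no factor -Y. -/
theorem stdDet_eq_sum (i₀ : α) (Y : A) (τ : Equiv.Perm α) :
    stdDet i₀ Y τ = ∑ s : Finset α with i₀ ∈ s, (-Y) ^ (s.card - 1) * borderedMinor A i₀ s τ := by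
  let P := (permMatrixOver A τ).updateRow i₀ 1
  let c : α → A := fun i => if i = i₀ then 1 else -Y
  have hsplit : ((1 - Y • permMatrixOver A τ).updateRow i₀ 1) =
      (fun i => c i • P i) + fun i => if i = i₀ then 0 else (1 : Matrix α α A) i := by
    ext i j
    by_cases h : i = i₀
    · subst h; simp [c, P]
    · simp [c, P, h]; ring
  rw [stdDet, hsplit]
  change Matrix.detRowAlternating.toMultilinearMap _ = _
  rw [MultilinearMap.map_add_univ, Finset.sum_filter]
  refine Finset.sum_congr rfl fun s _ => ?_
  split_ifs with hs
  · have h1 : s.piecewise (fun i => c i • P i)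
        (fun i => if i = i₀ then 0 else (1 : Matrix α α A) i) =
        s.piecewise (fun i => c i • (s.piecewise P.row (1 : Matrix α α A).row) i)
          (s.piecewise P.row (1 : Matrix α α A).row) := by
      ext i j
      by_cases hi : i ∈ s
      · simp [hi]
      · have : i ≠ i₀ := fun h => hi (h ▸ hs)
        simp [hi, this]
    have h2 : ∏ i ∈ s, c i = (-Y) ^ (s.card - 1) := by
      rw [← Finset.mul_prod_erase s c hs, ← Finset.card_erase_of_mem hs, ← Finset.prod_const]
      simp only [c, if_true, one_mul]
      exact Finset.prod_congr rfl fun i hi => if_neg (Finset.ne_of_mem_erase hi)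
    rw [h1, MultilinearMap.map_piecewise_smul, h2, smul_eq_mul]
    congr 1
    exact Matrix.det_piecewise_one_eq_submatrix_det P s
  · refine Matrix.det_eq_zero_of_row_eq_zero i₀ fun j => ?_
    simp [hs]

theorem sum_invariantColorings_mul_borderedMinor (i₀ : α) (k : ℕ) (s : Finset α) (hs : i₀ ∈ s)
    (τ : Equiv.Perm α) :
    ∑ π : Equiv.Perm α, (invariantColorings k π : A) * borderedMinor A i₀ s (τ * π) =
      ((Fintype.card α).factorial * (k + Fintype.card α - s.card).choose (Fintype.card α) : ℕ) *
        borderedMinor A i₀ s τ := by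
  have hle : s.card ≤ Fintype.card α := s.card_le_univ
  -- Both sides are the product of the integers from k - s + 1 to k + n - s, split on the right at
  -- k.
  have harith : (Fintype.card α).factorial *
      (k + Fintype.card α - s.card).choose (Fintype.card α) =
      k.descFactorial s.card * (k + 1).ascFactorial (Fintype.card α - s.card) := by
    rw [← Nat.descFactorial_eq_factorial_mul_choose, Nat.add_sub_assoc hle,
      ← Nat.descFactorial_mul_descFactorial (Nat.sub_le (Fintype.card α) s.card),
      Nat.add_descFactorial_eq_ascFactorial, Nat.add_sub_cancel, Nat.sub_sub_self hle]
  -- Right multiplication of τ by π permutes the columns of its matrix and preserves the row of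
  -- ones.
  have key := sum_invariantColorings_mul_det (A := A) k (Fintype.card α - s.card) α
    (Subtype.val : s → α) Subtype.val_injective (by simp; omega)
    (((permMatrixOver A τ).updateRow i₀ 1).submatrix (↑) id) ⟨i₀, hs⟩ (fun a => by simp)
  rw [Fintype.card_coe, ← harith] at key
  rw [borderedMinor]
  refine Eq.trans (Finset.sum_congr rfl fun π _ => ?_) key
  rw [borderedMinor]
  congr 2
  ext i j
  by_cases hi : (i : α) = i₀
  · simp [hi]
  · simp [hi, permMatrixOver_apply]
    rfl

theorem sum_invariantColorings_mul_stdDet (i₀ : α) (Y : A) (k : ℕ) (τ : Equiv.Perm α) :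
    ∑ π : Equiv.Perm α, (invariantColorings k π : A) * stdDet i₀ Y (τ * π) =
      (Fintype.card α).factorial * ∑ s : Finset α with i₀ ∈ s,
        (-Y) ^ (s.card - 1) * (k + Fintype.card α - s.card).choose (Fintype.card α) *
          borderedMinor A i₀ s τ := by
  simp only [stdDet_eq_sum, Finset.mul_sum]
  rw [Finset.sum_comm]
  refine Finset.sum_congr rfl fun s hs => ?_
  have h := sum_invariantColorings_mul_borderedMinor (A := A) i₀ k s (Finset.mem_filter.1 hs).2 τ
  simp only [mul_left_comm _ ((-Y) ^ _)]
  rw [← Finset.mul_sum, h]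
  push_cast
  ring

theorem borderedMinor_map {B : Type*} [CommRing B] (f : A →+* B) (i₀ : α) (s : Finset α)
    (τ : Equiv.Perm α) : f (borderedMinor A i₀ s τ) = borderedMinor B i₀ s τ := by
  rw [borderedMinor, RingHom.map_det, borderedMinor]
  congr 1
  ext i j
  by_cases hi : (i : α) = i₀ <;> simp [hi, permMatrixOver_apply, Matrix.updateRow_apply, apply_ite f]

theorem coeff_stdDet_mul_inv (i₀ : α) (τ : Equiv.Perm α) (m : ℕ) :
    (Fintype.card α).factorial * PowerSeries.coeff m (stdDet i₀ (PowerSeries.X : A⟦X⟧) τ *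
        PowerSeries.mk fun j => ((Fintype.card α + j).choose (Fintype.card α) : A)) =
      ∑ π : Equiv.Perm α, (invariantColorings (m + 1) π : A) * stdDet i₀ 1 (τ * π) := by
  rw [sum_invariantColorings_mul_stdDet, stdDet_eq_sum, Finset.sum_mul, map_sum]
  congr 1
  refine Finset.sum_congr rfl fun s hs => ?_
  have hpos : 0 < s.card := Finset.card_pos.2 ⟨i₀, (Finset.mem_filter.1 hs).2⟩
  have hle : s.card ≤ Fintype.card α := s.card_le_univ
  rw [← borderedMinor_map (PowerSeries.C (R := A)), neg_pow, neg_pow (1 : A), one_pow, mul_one]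
  have : ((-1) ^ (s.card - 1) * PowerSeries.X ^ (s.card - 1) *
      PowerSeries.C (borderedMinor A i₀ s τ) * PowerSeries.mk fun j =>
        ((Fintype.card α + j).choose (Fintype.card α) : A)) =
      PowerSeries.C ((-1) ^ (s.card - 1) * borderedMinor A i₀ s τ) *
        ((PowerSeries.mk fun j => ((Fintype.card α + j).choose (Fintype.card α) : A)) *
          PowerSeries.X ^ (s.card - 1)) := by
    simp only [map_mul, map_pow, map_neg, map_one]
    ring
  rw [this, PowerSeries.coeff_C_mul, PowerSeries.coeff_mul_X_pow']
  split_ifs with h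
  · rw [PowerSeries.coeff_mk, show Fintype.card α + (m - (s.card - 1)) =
      m + 1 + Fintype.card α - s.card by omega]
    ring
  -- For |s| - 1 > m the shifted series has no X^m term, and the binomial coefficient vanishes as
  -- its upper entry is below n.
  · rw [Nat.choose_eq_zero_of_lt (by omega)]
    simp

end

/-- The indicator of the points coloured unlike `i₀` is a nonzero σ-invariant vector. It vanishes at
`i₀`, so the row of ones does not matter and it lies in the left kernel. -/
theorem stdDet_one_eq_zero {n : ℕ} {σ : Equiv.Perm (Fin n)} (hσ : ¬IsNCycle σ) (i₀ : Fin n) :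
    stdDet i₀ (1 : ℂ) σ = 0 := by
  obtain ⟨f, hf, a, ha⟩ := exists_invariant_ne_of_not_isNCycle hσ i₀
  refine Matrix.exists_vecMul_eq_zero_iff.1 ⟨fun i => if f i = f i₀ then 0 else 1, fun h => ?_, ?_⟩
  · simpa [ha] using congrFun h a
  · ext j
    have : ∀ i, (if f i = f i₀ then (0 : ℂ) else 1) *
        (1 - (1 : ℂ) • permMatrixOver ℂ σ).updateRow i₀ 1 i j =
        (if f i = f i₀ then (0 : ℂ) else 1) * (if i = j then 1 else 0) -
        (if f i = f i₀ then (0 : ℂ) else 1) * (if i = σ j then 1 else 0) := by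
      intro i
      by_cases hi : i = i₀
      · simp [hi]
      · simp [hi, permMatrixOver_apply, Matrix.one_apply, mul_sub]
    simp only [Matrix.vecMul, dotProduct, this]
    simp [hf]

/-! ### The series P_i -/

theorem one_sub_X_mul_inv : (1 - PowerSeries.X : ℂ⟦X⟧) * (1 - PowerSeries.X)⁻¹ = 1 :=
  PowerSeries.mul_inv_cancel _ (by simp)

theorem inv_one_sub_X_pow (n : ℕ) :
    ((1 - PowerSeries.X : ℂ⟦X⟧) ^ n)⁻¹ = (1 - PowerSeries.X : ℂ⟦X⟧)⁻¹ ^ n := by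
  rw [PowerSeries.inv_eq_iff_mul_eq_one (by simp), ← mul_pow, mul_comm, one_sub_X_mul_inv, one_pow]

theorem inv_one_sub_X : (1 - PowerSeries.X : ℂ⟦X⟧)⁻¹ = PowerSeries.mk 1 := by
  rw [PowerSeries.inv_eq_iff_mul_eq_one (by simp), PowerSeries.mk_one_mul_one_sub_eq_one]

theorem zagierP_succ (i : ℕ) :
    zagierP (i + 1) = zagierP i + PowerSeries.X * PowerSeries.derivative ℂ (zagierP i) := by
  ext m
  cases m with
  | zero => simp [zagierP]
  | succ m =>
    rw [map_add, PowerSeries.coeff_succ_X_mul]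
    simp [zagierP, PowerSeries.coeff_derivative]
    ring

theorem X_mul_derivative_inv_one_sub_X :
    PowerSeries.X * PowerSeries.derivative ℂ (1 - PowerSeries.X : ℂ⟦X⟧)⁻¹ =
      (1 - PowerSeries.X : ℂ⟦X⟧)⁻¹ ^ 2 - (1 - PowerSeries.X : ℂ⟦X⟧)⁻¹ := by
  have h := one_sub_X_mul_inv
  rw [PowerSeries.derivative_inv']
  simp
  linear_combination (-(1 - PowerSeries.X : ℂ⟦X⟧)⁻¹) * h

/-- With u = 1/(1 - X), the relation X u' = u² - u shows that 1 + X d/dX, which takes P_i to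
P_(i+1), preserves ℤ[u]. -/
theorem zagierP_succ_of_eq_aeval {i : ℕ} {f : ℤ[X]}
    (h : zagierP i = Polynomial.aeval ((1 - PowerSeries.X : ℂ⟦X⟧)⁻¹) f) :
    zagierP (i + 1) = Polynomial.aeval ((1 - PowerSeries.X : ℂ⟦X⟧)⁻¹)
      (f + (Polynomial.X ^ 2 - Polynomial.X) * Polynomial.derivative f) := by
  have h1 : PowerSeries.derivative ℂ (zagierP i) =
      Polynomial.aeval ((1 - PowerSeries.X : ℂ⟦X⟧)⁻¹) (Polynomial.derivative f) *
        PowerSeries.derivative ℂ (1 - PowerSeries.X : ℂ⟦X⟧)⁻¹ := by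
    rw [h, ← smul_eq_mul]
    exact Derivation.map_aeval ((PowerSeries.derivative ℂ).restrictScalars ℤ) f _
  rw [zagierP_succ, h1, mul_left_comm, X_mul_derivative_inv_one_sub_X, h]
  simp
  ring

theorem zagierP_zero :
    zagierP 0 = Polynomial.aeval ((1 - PowerSeries.X : ℂ⟦X⟧)⁻¹) (Polynomial.X : ℤ[X]) := by
  rw [Polynomial.aeval_X, inv_one_sub_X]
  ext m
  simp [zagierP]

theorem exists_zagierP_eq_aeval (i : ℕ) :
    ∃ f : ℤ[X], zagierP i = Polynomial.aeval ((1 - PowerSeries.X : ℂ⟦X⟧)⁻¹) f := by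
  induction i with
  | zero => exact ⟨_, zagierP_zero⟩
  | succ i ih =>
    obtain ⟨f, hf⟩ := ih
    exact ⟨_, zagierP_succ_of_eq_aeval hf⟩

theorem zagierP_one : zagierP 1 = ((1 - PowerSeries.X : ℂ⟦X⟧) ^ 2)⁻¹ := by
  rw [zagierP_succ_of_eq_aeval zagierP_zero, inv_one_sub_X_pow]
  simp

theorem zagierP_two :
    zagierP 2 = (1 + PowerSeries.X) * ((1 - PowerSeries.X : ℂ⟦X⟧) ^ 3)⁻¹ := by
  rw [zagierP_succ_of_eq_aeval (zagierP_succ_of_eq_aeval zagierP_zero), inv_one_sub_X_pow]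
  have h := one_sub_X_mul_inv
  simp [map_ofNat (Polynomial.aeval (R := ℤ) (1 - PowerSeries.X : ℂ⟦X⟧)⁻¹)]
  generalize (1 - PowerSeries.X : ℂ⟦X⟧)⁻¹ = u at *
  linear_combination u ^ 2 * h

theorem zagierP_three : zagierP 3 = (1 + 4 * PowerSeries.X + PowerSeries.X ^ 2) *
    ((1 - PowerSeries.X : ℂ⟦X⟧) ^ 4)⁻¹ := by
  rw [zagierP_succ_of_eq_aeval (zagierP_succ_of_eq_aeval (zagierP_succ_of_eq_aeval zagierP_zero)),
    inv_one_sub_X_pow]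
  have h := one_sub_X_mul_inv
  simp [map_ofNat (Polynomial.aeval (R := ℤ) (1 - PowerSeries.X : ℂ⟦X⟧)⁻¹)]
  generalize (1 - PowerSeries.X : ℂ⟦X⟧)⁻¹ = u at *
  have hX : PowerSeries.X * u = u - 1 := by linear_combination -h
  linear_combination (-4 * u ^ 3 - u ^ 2 * (PowerSeries.X * u + (u - 1))) * hX

theorem coeff_sum_C_mul_zagierP (n : ℕ) (q : ℕ → ℂ) (m : ℕ) :
    PowerSeries.coeff m (∑ i ∈ Finset.Icc 1 n, PowerSeries.C (q i) * zagierP i) =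
      ∑ i ∈ Finset.Icc 1 n, q i * ((m + 1 : ℕ) : ℂ) ^ i := by
  simp [zagierP]

/-- The coefficient of X^m is the value at m + 1 of the polynomial with coefficients q_i, and
infinitely many values determine a polynomial. -/
theorem sum_C_mul_zagierP_injective {n : ℕ} {q p : ℕ → ℂ}
    (h : ∑ i ∈ Finset.Icc 1 n, PowerSeries.C (q i) * zagierP i =
      ∑ i ∈ Finset.Icc 1 n, PowerSeries.C (p i) * zagierP i) :
    ∀ i ∈ Finset.Icc 1 n, q i = p i := by
  let F : (ℕ → ℂ) → ℂ[X] := fun q => ∑ i ∈ Finset.Icc 1 n, Polynomial.monomial i (q i)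
  have hF : F q = F p := by
    refine Polynomial.eq_of_infinite_eval_eq _ _
      ((Set.infinite_range_of_injective (f := fun m : ℕ => ((m + 1 : ℕ) : ℂ))
        fun a b hab => by simpa using hab).mono ?_)
    rintro _ ⟨m, rfl⟩
    have := congrArg (PowerSeries.coeff m) h
    rw [coeff_sum_C_mul_zagierP, coeff_sum_C_mul_zagierP] at this
    simpa only [F, Set.mem_ofPred_eq, Polynomial.eval_finsetSum, Polynomial.eval_monomial]
  intro i hi
  have := congrArg (Polynomial.coeff · i) hF
  simpa [F, Polynomial.finsetSum_coeff, Polynomial.coeff_monomial, Finset.mem_Icc.1 hi] using this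

/-! ### Averaging over n-cycles and over the conjugacy class -/

theorem permCharPoly_coe {n : ℕ} (τ : Equiv.Perm (Fin n)) : (permCharPoly τ : ℂ⟦X⟧) =
    (1 - (PowerSeries.X : ℂ⟦X⟧) • permMatrixOver ℂ⟦X⟧ τ).det := by
  rw [permCharPoly, ← Polynomial.coeToPowerSeries.ringHom_apply, RingHom.map_det]
  congr 1
  ext i j : 2
  by_cases h : i = j <;>
    simp [permRepMatrix, permMatrixOver, h, apply_ite (Polynomial.C : ℂ → ℂ[X]),
      apply_ite (Polynomial.toPowerSeries : ℂ[X] → ℂ⟦X⟧)]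

theorem permCharPoly_conj {n : ℕ} (g τ : Equiv.Perm (Fin n)) :
    permCharPoly (g * τ * g⁻¹) = permCharPoly τ := by
  rw [permCharPoly, ← Matrix.det_submatrix_equiv_self g, permCharPoly]
  congr 1
  ext i j : 2
  simp [Matrix.one_apply, permRepMatrix]

theorem permCharPoly_inv {n : ℕ} (τ : Equiv.Perm (Fin n)) :
    permCharPoly τ⁻¹ = permCharPoly τ := by
  rw [permCharPoly, ← Matrix.det_transpose, permCharPoly]
  congr 1
  ext i j : 2
  simp only [Matrix.transpose_apply, Matrix.sub_apply, Matrix.smul_apply, Matrix.map_apply,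
    permRepMatrix, Matrix.of_apply, Matrix.one_apply, Equiv.Perm.eq_inv_iff_eq, eq_comm]

theorem permCharPoly_mul_inv {n : ℕ} (i₀ : Fin n) (τ : Equiv.Perm (Fin n)) :
    (permCharPoly τ : ℂ⟦X⟧) * ((1 - PowerSeries.X : ℂ⟦X⟧) ^ (n + 2))⁻¹ =
      stdDet i₀ (PowerSeries.X : ℂ⟦X⟧) τ * PowerSeries.mk fun j => ((n + j).choose n : ℂ) := by
  rw [permCharPoly_coe, det_one_sub_smul_permMatrixOver i₀,
    ← PowerSeries.mk_one_pow_eq_mk_choose_add, ← inv_one_sub_X, inv_one_sub_X_pow]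
  have h := one_sub_X_mul_inv
  rw [pow_succ _ (n + 1)]
  linear_combination stdDet i₀ (PowerSeries.X : ℂ⟦X⟧) τ * (1 - PowerSeries.X : ℂ⟦X⟧)⁻¹ ^ (n + 1) * h

theorem sum_pow_numCycles_mul_stdDet {n : ℕ} (i₀ : Fin n) (ρ : Equiv.Perm (Fin n)) (m : ℕ) :
    ∑ σ : Equiv.Perm (Fin n), ((m + 1 : ℕ) : ℂ) ^ numCycles (ρ * σ) * stdDet i₀ 1 σ =
      n.factorial * PowerSeries.coeff m
        ((permCharPoly ρ : ℂ⟦X⟧) * ((1 - PowerSeries.X : ℂ⟦X⟧) ^ (n + 2))⁻¹) := by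
  -- The substitution π = ρσ turns the weight at ρ⁻¹π into the weight at σ; passing to ρ⁻¹ only
  -- transposes the matrix.
  have h := coeff_stdDet_mul_inv (A := ℂ) i₀ ρ⁻¹ m
  rw [Fintype.card_fin, ← permCharPoly_mul_inv, permCharPoly_inv] at h
  rw [h, ← Equiv.sum_comp (Equiv.mulLeft ρ) fun π => _ * stdDet i₀ 1 (ρ⁻¹ * π)]
  simp [invariantColorings_eq_pow]

theorem sum_stdDet_one {n : ℕ} (i₀ : Fin n) :
    ∑ σ : Equiv.Perm (Fin n), stdDet i₀ (1 : ℂ) σ = n.factorial := by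
  -- With one colour all powers are 1, and only a constant term remains on the right.
  have h := sum_pow_numCycles_mul_stdDet i₀ 1 0
  have h0 : PowerSeries.constantCoeff (permCharPoly (1 : Equiv.Perm (Fin n)) : ℂ⟦X⟧) = 1 := by
    rw [permCharPoly_coe, RingHom.map_det]
    convert Matrix.det_one (n := Fin n) (R := ℂ)
    ext i j
    by_cases hij : i = j <;> simp [Matrix.one_apply, hij]
  simpa [h0] using h

theorem mem_carrier_conj {n : ℕ} {K : ConjClasses (Equiv.Perm (Fin n))} (g ρ : Equiv.Perm (Fin n)) :
    g * ρ * g⁻¹ ∈ K.carrier ↔ ρ ∈ K.carrier := by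
  rw [ConjClasses.mem_carrier_iff_mk_eq, ConjClasses.mem_carrier_iff_mk_eq,
    ConjClasses.mk_eq_mk_iff_isConj.2 (isConj_iff.2 ⟨g, rfl⟩ : IsConj ρ (g * ρ * g⁻¹))]

-- The sum over K and all σ' of k^ℓ(ρσ') D_1(σ'), with k = m + 1, is evaluated in two ways. For
-- fixed ρ it is a coefficient depending only on K; for fixed σ' it vanishes unless σ' is an
-- n-cycle, and then conjugating σ' to σ permutes K.
open Classical in
theorem sum_carrier_pow_numCycles {n : ℕ} (K : ConjClasses (Equiv.Perm (Fin n)))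
    {σ : Equiv.Perm (Fin n)} (hσ : IsNCycle σ) {τ : Equiv.Perm (Fin n)} (hτ : τ ∈ K.carrier)
    (m : ℕ) :
    ∑ ρ ∈ K.carrier.toFinset, ((m + 1 : ℕ) : ℂ) ^ numCycles (ρ * σ) =
      K.carrier.toFinset.card * PowerSeries.coeff m
        ((permCharPoly τ : ℂ⟦X⟧) * ((1 - PowerSeries.X : ℂ⟦X⟧) ^ (n + 2))⁻¹) := by
  let i₀ : Fin n := ⟨0, Nat.pos_of_ne_zero hσ.ne_zero⟩
  have hconj : ∀ ρ ∈ K.carrier, permCharPoly ρ = permCharPoly τ := by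
    intro ρ hρ
    rw [ConjClasses.mem_carrier_iff_mk_eq] at hρ hτ
    obtain ⟨g, rfl⟩ := isConj_iff.1 (ConjClasses.mk_eq_mk_iff_isConj.1 (hτ.trans hρ.symm))
    exact permCharPoly_conj g τ
  have hcyc : ∀ σ' : Equiv.Perm (Fin n),
      ∑ ρ ∈ K.carrier.toFinset, ((m + 1 : ℕ) : ℂ) ^ numCycles (ρ * σ') * stdDet i₀ 1 σ' =
      (∑ ρ ∈ K.carrier.toFinset, ((m + 1 : ℕ) : ℂ) ^ numCycles (ρ * σ)) * stdDet i₀ 1 σ' := by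
    intro σ'
    by_cases h : IsNCycle σ'
    · obtain ⟨g, rfl⟩ := isConj_iff.1 (hσ.isConj h)
      rw [← Finset.sum_mul]
      congr 1
      refine (Finset.sum_equiv (MulAut.conj g).toEquiv (fun ρ => ?_) fun ρ _ => ?_).symm
      · simp [mem_carrier_conj]
      · rw [← numCycles_conj g (ρ * σ)]
        simp [mul_assoc]
    · simp [stdDet_one_eq_zero h i₀]
  have hfac : (n.factorial : ℂ) ≠ 0 := Nat.cast_ne_zero.2 n.factorial_ne_zero
  refine mul_right_cancel₀ hfac ?_
  rw [← sum_stdDet_one i₀, Finset.mul_sum, ← Finset.sum_congr rfl fun σ' _ => hcyc σ',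
    Finset.sum_comm, Finset.sum_congr rfl fun ρ hρ => by
      rw [sum_pow_numCycles_mul_stdDet i₀ ρ m, hconj ρ (Set.mem_toFinset.1 hρ)],
    Finset.sum_const, nsmul_eq_mul, sum_stdDet_one]
  ring

open Classical in
theorem sum_cycleProportion_mul_pow {n : ℕ} (hn : n ≠ 0) (K : ConjClasses (Equiv.Perm (Fin n)))
    (σ : Equiv.Perm (Fin n)) (x : ℂ) :
    ∑ i ∈ Finset.Icc 1 n, (cycleProportion K σ i : ℂ) * x ^ i =
      (∑ ρ ∈ K.carrier.toFinset, x ^ numCycles (ρ * σ)) / K.carrier.toFinset.card := by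
  rw [← Finset.sum_fiberwise_of_maps_to (s := K.carrier.toFinset) (t := Finset.Icc 1 n)
    (g := fun ρ : Equiv.Perm (Fin n) => numCycles (ρ * σ)) fun ρ _ =>
      Finset.mem_Icc.2 ⟨numCycles_pos hn _, numCycles_le _⟩, Finset.sum_div]
  refine Finset.sum_congr rfl fun i _ => ?_
  have h1 : ({τ : Equiv.Perm (Fin n) | τ ∈ K.carrier ∧ numCycles (τ * σ) = i}).ncard =
      (K.carrier.toFinset.filter fun ρ => numCycles (ρ * σ) = i).card := by
    rw [← Set.ncard_coe_finset]
    congr 1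
    ext ρ
    simp
  rw [Finset.sum_congr rfl (g := fun _ => x ^ i) fun ρ hρ => by rw [(Finset.mem_filter.1 hρ).2],
    Finset.sum_const, nsmul_eq_mul, cycleProportion, h1, Set.ncard_eq_toFinset_card']
  push_cast
  ring

theorem sum_cycleProportion_mul_zagierP {n : ℕ} (K : ConjClasses (Equiv.Perm (Fin n)))
    {σ : Equiv.Perm (Fin n)} (hσ : IsNCycle σ) {τ : Equiv.Perm (Fin n)} (hτ : τ ∈ K.carrier) :
    ∑ i ∈ Finset.Icc 1 n, PowerSeries.C (cycleProportion K σ i : ℂ) * zagierP i =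
      (permCharPoly τ : ℂ⟦X⟧) * ((1 - PowerSeries.X : ℂ⟦X⟧) ^ (n + 2))⁻¹ := by
  classical
  ext m
  have hK : (K.carrier.toFinset.card : ℂ) ≠ 0 :=
    Nat.cast_ne_zero.2 (Finset.card_ne_zero_of_mem (Set.mem_toFinset.2 hτ))
  rw [coeff_sum_C_mul_zagierP, sum_cycleProportion_mul_pow hσ.ne_zero,
    sum_carrier_pow_numCycles K hσ hτ, mul_div_cancel_left₀ _ hK]

theorem mainTheorem9 (n : ℕ) (K : ConjClasses (Equiv.Perm (Fin n)))
    (σ : Equiv.Perm (Fin n)) (hσ : IsNCycle σ) :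
    -- the identity, with `det(1 - τX, ℂ^n)` computed at any `τ ∈ K`
    (∀ τ ∈ K.carrier,
      ∑ i ∈ Finset.Icc 1 n, PowerSeries.C (cycleProportion K σ i : ℂ) * zagierP i =
        (permCharPoly τ : ℂ⟦X⟧) * ((1 - PowerSeries.X : ℂ⟦X⟧) ^ (n + 2))⁻¹) ∧
    -- the identity determines the numbers `p_1(K), …, p_n(K)`
    (∀ τ ∈ K.carrier, ∀ q : ℕ → ℂ,
      ∑ i ∈ Finset.Icc 1 n, PowerSeries.C (q i) * zagierP i =
        (permCharPoly τ : ℂ⟦X⟧) * ((1 - PowerSeries.X : ℂ⟦X⟧) ^ (n + 2))⁻¹ →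
      ∀ i ∈ Finset.Icc 1 n, q i = (cycleProportion K σ i : ℂ)) ∧
    -- the `P_i` are polynomials in `1 / (1 - X)`, and the first three of them
    (∀ i : ℕ, 1 ≤ i → ∃ f : ℤ[X],
      zagierP i = Polynomial.aeval ((1 - PowerSeries.X : ℂ⟦X⟧)⁻¹) f) ∧
    zagierP 1 = ((1 - PowerSeries.X : ℂ⟦X⟧) ^ 2)⁻¹ ∧
    zagierP 2 = (1 + PowerSeries.X) * ((1 - PowerSeries.X : ℂ⟦X⟧) ^ 3)⁻¹ ∧
    zagierP 3 = (1 + 4 * PowerSeries.X + PowerSeries.X ^ 2) *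
      ((1 - PowerSeries.X : ℂ⟦X⟧) ^ 4)⁻¹ := by
  refine ⟨fun τ hτ => sum_cycleProportion_mul_zagierP K hσ hτ, fun τ hτ q hq => ?_,
    fun i _ => exists_zagierP_eq_aeval i, zagierP_one, zagierP_two, zagierP_three⟩
  exact sum_C_mul_zagierP_injective (hq.trans (sum_cycleProportion_mul_zagierP K hσ hτ).symm)
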